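/- A dataset consists of a matrix $X \in \mathbb{R}^{m \times n}$ ($m$ data objects, $n$ features; $m, n \ge 0$) and a prediction target $y \in \{0,1\}^m$. A subgroup is given by bounds $\mathit{lb}, \mathit{ub} \in (\mathbb{R} \cup \{-\infty,+\infty\})^n$; data object $i$ is a member of it if $\mathit{lb}_j \le X_{ij} \le \mathit{ub}_j$ for all $j \in \{1,\dots,n\}$. A notion of subgroup quality is a function assigning to $\mathit{lb}, \mathit{ub}, X, y$ a real number $Q(\mathit{lb},\mathit{ub},X,y)$; subgroup discovery for $Q$ is the problem of finding, given $X$ and $y$, bounds $\mathit{lb}, \mathit{ub}$ that maximize $Q(\mathit{lb},\mathit{ub},X,y)$. Running times are counted on a real RAM: programs operate on finitely many arrays of natural numbers (constants, addition, truncated subtraction, comparison, indirect addressing) and finitely many arrays of extended real numbers (copying, comparison, field operations), every assignment and every test costs one step, and the working memory is initially arbitrary. The size $|x|$ of an instance $x$ is the number of memory cells it occupies, which is $2 + m + mn$ for the dataset $(X,y)$ (the numbers $m$ and $n$, the target, and the matrix). A problem is in $\mathcal{XP}$ for a parameter $\kappa$ if there are a single program and computable functions $f, g : \mathbb{N} \to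 \mathbb{N}$ such that the program solves every instance $x$ within $f(\kappa(x)) \cdot |x|^{g(\kappa(x))}$ steps. **Proposition.** Let $Q$ be a notion of subgroup quality such that, on each dataset, subgroups with the same members have the same quality, and such that $Q(\mathit{lb},\mathit{ub},X,y)$ can be computed from $\mathit{lb},\mathit{ub},X,y$ in time polynomial in the size of this input. Then subgroup discovery for $Q$ is in the parameterized complexity class $\mathcal{XP}$ for the parameter $n$, the number of features. In particular, this holds without further assumptions for Weighted Relative Accuracy $$\mathrm{WRAcc} = \frac{m_b}{m}\left(\frac{m_b^+}{m_b} - \frac{m^+}{m}\right),$$ where $m_b$ is the number of members of the subgroup, $m^+$ the number of data objects with $y_i = 1$, and $m_b^+$ the number of members with $y_i = 1$ ($\mathrm{WRAcc}$ is $0$ if $m_b = 0$). -/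

import Mathlib

/-! ### The real RAM

A program works on finitely many named arrays of natural numbers (counters and addresses) and
finitely many named arrays of extended real numbers (data).  Natural numbers can be added,
subtracted and compared; data can be copied, compared and combined by the four field operations.
There is no multiplication of natural numbers and no conversion (rounding) from data to natural
numbers.  Every assignment and every evaluation of a test costs one step. -/

namespace RealRAM

/-- Memory: `nat a i` and `dat a i` are the `i`-th cells of the arrays with name `a`. -/
structure Mem where
  nat : ℕ → ℕ → ℕ
  dat : ℕ → ℕ → EReal

/-- Expressions for natural numbers; `get a e` reads cell `e` of the array `a`, and `sub` is
truncated subtraction. -/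
inductive NExp where
  | lit (c : ℕ)
  | get (a : ℕ) (e : NExp)
  | add (e₁ e₂ : NExp)
  | sub (e₁ e₂ : NExp)

/-- Expressions for data; `get a e` reads cell `e` of the array `a`. -/
inductive DExp where
  | ofNat (e : NExp)
  | top
  | bot
  | get (a : ℕ) (e : NExp)
  | add (x₁ x₂ : DExp)
  | sub (x₁ x₂ : DExp)
  | mul (x₁ x₂ : DExp)
  | div (x₁ x₂ : DExp)

/-- Tests compare two natural numbers or two data values. -/
inductive Test where
  | natLt (e₁ e₂ : NExp)
  | datLe (x₁ x₂ : DExp)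

/-- Programs. -/
inductive Prog where
  | skip
  | setNat (a : ℕ) (pos val : NExp)
  | setDat (a : ℕ) (pos : NExp) (val : DExp)
  | seq (p q : Prog)
  | ite (b : Test) (p q : Prog)
  | while (b : Test) (p : Prog)

/-- Value of a natural-number expression. -/
def NExp.val (s : Mem) : NExp → ℕ
  | lit c => c
  | get a e => s.nat a (e.val s)
  | add e₁ e₂ => e₁.val s + e₂.val s
  | sub e₁ e₂ => e₁.val s - e₂.val s

/-- Value of a data expression.  On finite operands with nonzero divisor the operations are those
of the field of real numbers. -/
noncomputable def DExp.val (s : Mem) : DExp → EReal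
  | ofNat e => ((e.val s : ℝ) : EReal)
  | top => ⊤
  | bot => ⊥
  | get a e => s.dat a (e.val s)
  | add x₁ x₂ => x₁.val s + x₂.val s
  | sub x₁ x₂ => x₁.val s - x₂.val s
  | mul x₁ x₂ => x₁.val s * x₂.val s
  | div x₁ x₂ => x₁.val s / x₂.val s

/-- Truth of a test. -/
def Test.Holds (s : Mem) : Test → Prop
  | natLt e₁ e₂ => e₁.val s < e₂.val s
  | datLe x₁ x₂ => x₁.val s ≤ x₂.val s

/-- Writing `v` into cell `i` of the natural-number array `a`. -/
def Mem.setNat (s : Mem) (a i v : ℕ) : Mem :=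
  { s with nat := Function.update s.nat a (Function.update (s.nat a) i v) }

/-- Writing `v` into cell `i` of the data array `a`. -/
def Mem.setDat (s : Mem) (a i : ℕ) (v : EReal) : Mem :=
  { s with dat := Function.update s.dat a (Function.update (s.dat a) i v) }

/-- `Exec p s s' t`: started in memory `s`, the program `p` halts in memory `s'` after exactly
`t` steps. -/
inductive Exec : Prog → Mem → Mem → ℕ → Prop where
  | skip (s : Mem) : Exec .skip s s 1
  | setNat (s : Mem) (a : ℕ) (pos val : NExp) :
      Exec (.setNat a pos val) s (s.setNat a (pos.val s) (val.val s)) 1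
  | setDat (s : Mem) (a : ℕ) (pos : NExp) (val : DExp) :
      Exec (.setDat a pos val) s (s.setDat a (pos.val s) (val.val s)) 1
  | seq {p q : Prog} {s s₁ s₂ : Mem} {t₁ t₂ : ℕ} :
      Exec p s s₁ t₁ → Exec q s₁ s₂ t₂ → Exec (.seq p q) s s₂ (t₁ + t₂)
  | iteTrue {b : Test} {p q : Prog} {s s₁ : Mem} {t : ℕ} :
      b.Holds s → Exec p s s₁ t → Exec (.ite b p q) s s₁ (t + 1)
  | iteFalse {b : Test} {p q : Prog} {s s₁ : Mem} {t : ℕ} :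
      ¬ b.Holds s → Exec q s s₁ t → Exec (.ite b p q) s s₁ (t + 1)
  | whileFalse {b : Test} {p : Prog} {s : Mem} :
      ¬ b.Holds s → Exec (.while b p) s s 1
  | whileTrue {b : Test} {p : Prog} {s s₁ s₂ : Mem} {t₁ t₂ : ℕ} :
      b.Holds s → Exec p s s₁ t₁ → Exec (.while b p) s₁ s₂ t₂ →
        Exec (.while b p) s s₂ (t₁ + t₂ + 1)

/-- Inputs and outputs of programs: a finite list of natural numbers and a finite list of data. -/
structure Word where
  nats : List ℕ
  data : List EReal

/-- Number of memory cells that a word occupies. -/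
def Word.size (w : Word) : ℕ := w.nats.length + w.data.length

/-- The word `w` stands at the beginning of the two arrays with name `a`; all other memory cells
are arbitrary. -/
def Mem.Stores (s : Mem) (a : ℕ) (w : Word) : Prop :=
  (∀ (i : ℕ) (h : i < w.nats.length), s.nat a i = w.nats[i]) ∧
  (∀ (i : ℕ) (h : i < w.data.length), s.dat a i = w.data[i])

/-- A search problem: every instance has a set of admissible solutions, one of which has to be
found. -/
structure Problem where
  Inst : Type
  Sol : Inst → Type
  IsSolution : (x : Inst) → Sol x → Prop
  encodeInst : Inst → Word
  encodeSol : (x : Inst) → Sol x → Word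

/-- The size of an instance is the number of memory cells that it occupies. -/
def Problem.size (P : Problem) (x : P.Inst) : ℕ := (P.encodeInst x).size

/-- The program `p` solves the problem `P`, within `T x` steps on each instance `x`: whenever the
instance is stored in the arrays `0` (and the working memory is arbitrary), `p` halts after at most
`T x` steps with some admissible solution stored in the arrays `1`. -/
def Prog.SolvesInTime (p : Prog) (P : Problem) (T : P.Inst → ℕ) : Prop :=
  ∀ (x : P.Inst) (s : Mem), s.Stores 0 (P.encodeInst x) →
    ∃ (s' : Mem) (t : ℕ) (z : P.Sol x),
      Exec p s s' t ∧ t ≤ T x ∧ P.IsSolution x z ∧ s'.Stores 1 (P.encodeSol x z)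

/-- Problems that some program solves in time polynomial in the size of the instance. -/
def Problem.InPolyTime (P : Problem) : Prop :=
  ∃ (p : Prog) (T : Polynomial ℕ), p.SolvesInTime P fun x => T.eval (P.size x)

/-- The parameterized class XP: a single program solves all instances `x` with parameter
`κ x = k` in time `f k * |x| ^ g k`, for computable functions `f` and `g`. -/
def Problem.InXP (P : Problem) (κ : P.Inst → ℕ) : Prop :=
  ∃ (p : Prog) (f g : ℕ → ℕ), Computable f ∧ Computable g ∧
    p.SolvesInTime P fun x => f (κ x) * P.size x ^ g (κ x)

end RealRAM

/-! ### Subgroup discovery -/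

namespace SubgroupDiscovery

open RealRAM

/-- A real-valued dataset with `m` data objects (rows) and `n` features (columns), together with a
binary prediction target. -/
structure Dataset where
  m : ℕ
  n : ℕ
  X : Matrix (Fin m) (Fin n) ℝ
  y : Fin m → Bool

/-- A subgroup description: lower and upper bounds for all features, possibly infinite. -/
structure Subgroup (n : ℕ) where
  lb : Fin n → EReal
  ub : Fin n → EReal

/-- Data object `i` is a member of the subgroup `S`. -/
def IsMember (D : Dataset) (S : Subgroup D.n) (i : Fin D.m) : Prop :=
  ∀ j : Fin D.n, (D.X i j : EReal) ≥ S.lb j ∧ (D.X i j : EReal) ≤ S.ub j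

/-- A notion of subgroup quality: `Q D S` is the quality of the subgroup `S` on the
dataset `D`. -/
abbrev Quality : Type := (D : Dataset) → Subgroup D.n → ℝ

/-- On each dataset, subgroups with the same members have the same quality. -/
def Quality.DependsOnMembers (Q : Quality) : Prop :=
  ∀ (D : Dataset) (S S' : Subgroup D.n),
    (∀ i, IsMember D S i ↔ IsMember D S' i) → Q D S = Q D S'

/-- The natural numbers in the encoding of a dataset: `m`, `n`, and the target (`0` or `1`). -/
def Dataset.encodeNats (D : Dataset) : List ℕ :=
  [D.m, D.n] ++ List.ofFn fun i => (D.y i).toNat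

/-- The data in the encoding of a dataset: the entries of the matrix, row by row. -/
def Dataset.encodeData (D : Dataset) : List EReal :=
  List.ofFn fun k : Fin (D.m * D.n) => ((D.X k.divNat k.modNat : ℝ) : EReal)

/-- The encoding of a subgroup: lower bounds, then upper bounds. -/
def Subgroup.encodeData {n : ℕ} (S : Subgroup n) : List EReal :=
  List.ofFn S.lb ++ List.ofFn S.ub

/-- The problem of evaluating the quality of a given subgroup on a given dataset. -/
def evaluation (Q : Quality) : Problem where
  Inst := (D : Dataset) × Subgroup D.n
  Sol := fun _ => ℝ
  IsSolution := fun x v => v = Q x.1 x.2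
  encodeInst := fun x => ⟨x.1.encodeNats, x.1.encodeData ++ x.2.encodeData⟩
  encodeSol := fun _ v => ⟨[], [(v : EReal)]⟩

/-- Subgroup discovery: the problem of finding a subgroup that maximizes the quality on a given
dataset. -/
def discovery (Q : Quality) : Problem where
  Inst := Dataset
  Sol := fun D => Subgroup D.n
  IsSolution := fun D S => ∀ S' : Subgroup D.n, Q D S' ≤ Q D S
  encodeInst := fun D => ⟨D.encodeNats, D.encodeData⟩
  encodeSol := fun _ S => ⟨[], S.encodeData⟩

/-- Weighted Relative Accuracy `(m_b / m) * (m_b⁺ / m_b - m⁺ / m)`, where `m_b` counts the members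
of the subgroup, `m⁺` the positive data objects and `m_b⁺` the positive members.  Its value is `0`
if the subgroup has no members. -/
noncomputable def wracc : Quality := fun D S =>
  let mb : ℝ := Nat.card {i // IsMember D S i}
  let mpos : ℝ := Nat.card {i // D.y i = true}
  let mbpos : ℝ := Nat.card {i // IsMember D S i ∧ D.y i = true}
  mb / D.m * (mbpos / mb - mpos / D.m)

end SubgroupDiscovery

/-! Only finitely many subgroups matter. If a subgroup has members, each bound can be tightened to
the minimum or maximum of its feature over the members; this keeps the members, and the new bounds
are matrix entries. A subgroup without members can be replaced by one whose bounds are all `⊤`.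
Hence it suffices to try the subgroups whose 2n bounds are copied from the mn matrix entries or from
a cell containing `⊤` (`Dataset.exists_candidate`): a quality that depends only on the members is
maximized by one of these.

A candidate is a list of 2n addresses below mn + 2, in other words a number with 2n digits in base
mn + 2. The search counts through these (mn + 2)^(2n) numbers, evaluates each candidate and keeps a
best one (`Runs.increment`, `runs_searchStep`, `solves_discoveryProg`). The evaluating program is a
black box; by `Exec.frame` it cannot disturb arrays with large names, which serve as the memory of
the search. The total time is about (mn + 2)^(2n) times a polynomial in the instance size and n,
which `search_time_le` brings into the form required by XP.

For WRAcc it remains to exhibit an evaluating program; the one given runs in time linear in the size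
of its input (`evaluation_wracc_inPolyTime`). -/

namespace RealRAM

/-! ### A Hoare-style calculus with step counts -/

/-- Started in memory `s`, the program `p` halts after at most `T` steps in a memory that
satisfies `Q`. -/
def Runs (p : Prog) (s : Mem) (T : ℕ) (Q : Mem → Prop) : Prop :=
  ∃ s' t, Exec p s s' t ∧ t ≤ T ∧ Q s'

@[simp] theorem Mem.setNat_nat (s : Mem) (a i v b j : ℕ) :
    (s.setNat a i v).nat b j = if b = a ∧ j = i then v else s.nat b j := by
  by_cases h : b = a
  · subst h; by_cases h' : j = i <;> simp [Mem.setNat, h']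
  · simp [Mem.setNat, h]

@[simp] theorem Mem.setNat_dat (s : Mem) (a i v : ℕ) : (s.setNat a i v).dat = s.dat := rfl

@[simp] theorem Mem.setDat_dat (s : Mem) (a i : ℕ) (v : EReal) (b j : ℕ) :
    (s.setDat a i v).dat b j = if b = a ∧ j = i then v else s.dat b j := by
  by_cases h : b = a
  · subst h; by_cases h' : j = i <;> simp [Mem.setDat, h']
  · simp [Mem.setDat, h]

@[simp] theorem Mem.setDat_nat (s : Mem) (a i : ℕ) (v : EReal) : (s.setDat a i v).nat = s.nat := rfl

namespace Runs

variable {p q : Prog} {s : Mem} {T T₁ T₂ : ℕ} {P Q : Mem → Prop}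

theorem mono (h : Runs p s T₁ P) (hT : T₁ ≤ T₂) (hQ : ∀ s', P s' → Q s') : Runs p s T₂ Q := by
  obtain ⟨s', t, he, ht, hp⟩ := h
  exact ⟨s', t, he, ht.trans hT, hQ _ hp⟩

theorem skip (h : Q s) : Runs .skip s 1 Q := ⟨_, _, .skip s, le_rfl, h⟩

theorem setNat {a : ℕ} {e v : NExp} (h : Q (s.setNat a (e.val s) (v.val s))) :
    Runs (.setNat a e v) s 1 Q := ⟨_, _, .setNat s a e v, le_rfl, h⟩

theorem setDat {a : ℕ} {e : NExp} {v : DExp} (h : Q (s.setDat a (e.val s) (v.val s))) :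
    Runs (.setDat a e v) s 1 Q := ⟨_, _, .setDat s a e v, le_rfl, h⟩

theorem seq (hp : Runs p s T₁ P) (hq : ∀ s', P s' → Runs q s' T₂ Q) :
    Runs (.seq p q) s (T₁ + T₂) Q := by
  obtain ⟨s₁, t₁, h₁, ht₁, h⟩ := hp
  obtain ⟨s₂, t₂, h₂, ht₂, h⟩ := hq _ h
  exact ⟨s₂, _, .seq h₁ h₂, by omega, h⟩

theorem ite {b : Test} (hp : b.Holds s → Runs p s T Q) (hq : ¬ b.Holds s → Runs q s T Q) :
    Runs (.ite b p q) s (T + 1) Q := by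
  by_cases hb : b.Holds s
  · obtain ⟨s', t, h, ht, hQ⟩ := hp hb
    exact ⟨s', _, .iteTrue hb h, by omega, hQ⟩
  · obtain ⟨s', t, h, ht, hQ⟩ := hq hb
    exact ⟨s', _, .iteFalse hb h, by omega, hQ⟩

/-- A loop with an invariant `I` indexed by the number of completed rounds, where the loop runs
for at most `n` rounds. -/
theorem while_le {b : Test} (I : ℕ → Mem → Prop) (n k : ℕ) (hk : k ≤ n)
    (hb : ∀ k s, I k s → b.Holds s → k < n ∧ Runs p s T (I (k + 1))) (h : I k s) :
    Runs (.while b p) s ((n - k) * (T + 1) + 1) (fun s' => (∃ k ≤ n, I k s') ∧ ¬ b.Holds s') := by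
  induction hd : n - k generalizing k s with
  | zero =>
    by_cases hs : b.Holds s
    · have := (hb k s h hs).1; omega
    · exact ⟨s, 1, .whileFalse hs, by omega, ⟨k, hk, h⟩, hs⟩
  | succ d ih =>
    by_cases hs : b.Holds s
    · obtain ⟨hkn, s₁, t₁, h₁, ht₁, hI⟩ := hb k s h hs
      obtain ⟨s₂, t₂, h₂, ht₂, hQ⟩ := ih (k + 1) hkn hI (by omega)
      refine ⟨s₂, _, .whileTrue hs h₁ h₂, ?_, hQ⟩
      rw [add_mul]; omega
    · exact ⟨s, 1, .whileFalse hs, by omega, ⟨k, hk, h⟩, hs⟩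

/-- A loop that runs for exactly `n` rounds. -/
theorem while_eq {b : Test} (I : ℕ → Mem → Prop) (n : ℕ)
    (hb : ∀ k s, k ≤ n → I k s → (b.Holds s ↔ k < n))
    (hp : ∀ k s, k < n → I k s → Runs p s T (I (k + 1))) (h : I 0 s) :
    Runs (.while b p) s (n * (T + 1) + 1) (I n) := by
  refine (while_le (T := T) (fun k s => k ≤ n ∧ I k s) n 0 (Nat.zero_le _) ?_
    ⟨Nat.zero_le _, h⟩).mono le_rfl ?_
  · rintro k s ⟨hk, hI⟩ hs
    have hkn := (hb k s hk hI).1 hs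
    exact ⟨hkn, (hp k s hkn hI).mono le_rfl fun s' h' => ⟨hkn, h'⟩⟩
  · rintro s' ⟨⟨k, hk, -, hI⟩, hs⟩
    obtain rfl : k = n := by
      by_contra hne
      exact hs ((hb k s' hk hI).2 (by omega))
    exact hI

end Runs

/-! ### Counting loops -/

/-- `for c < e do p`, where the counter is cell `0` of the array `c`. -/
def Prog.forLt (c : ℕ) (e : NExp) (p : Prog) : Prog :=
  .seq (.setNat c (.lit 0) (.lit 0))
    (.while (.natLt (.get c (.lit 0)) e)
      (.seq p (.setNat c (.lit 0) (.add (.get c (.lit 0)) (.lit 1)))))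

/-- The invariant records the counter, so the body has to establish it for the memory after the
counter update. The test and that update cost two steps per round; the last two steps are the
initialization and the failing test. -/
theorem Runs.forLt {c : ℕ} {e : NExp} {p : Prog} {s : Mem} {T : ℕ} (I : ℕ → Mem → Prop) (n : ℕ)
    (he : ∀ k s, k ≤ n → I k s → e.val s = n ∧ s.nat c 0 = k)
    (hp : ∀ k s, k < n → I k s →
      Runs p s T (fun s' => s'.nat c 0 = k ∧ I (k + 1) (s'.setNat c 0 (k + 1))))
    (h : I 0 (s.setNat c 0 0)) :
    Runs (.forLt c e p) s (n * (T + 2) + 2) (I n) := by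
  refine (Runs.seq (P := I 0) (Runs.setNat (by simpa [NExp.val] using h)) fun s' hs' =>
    Runs.while_eq (T := T + 1) I n ?_ ?_ hs').mono ?_ fun _ h => h
  · intro k s hk hI
    obtain ⟨h1, h2⟩ := he k s hk hI
    simp [Test.Holds, NExp.val, h1, h2]
  · intro k s hk hI
    refine Runs.seq (hp k s hk hI) fun s' hs' => Runs.setNat ?_
    simpa [NExp.val, hs'.1] using hs'.2
  · apply le_of_eq; ring

/-- Filling an initial segment of an array of natural numbers. -/
theorem Runs.fillNat {c a : ℕ} {e v : NExp} {s : Mem} (n : ℕ) (w : ℕ → ℕ) (hac : a ≠ c)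
    (hs : ∀ s' : Mem, s'.dat = s.dat → (∀ x, x ≠ a → x ≠ c → s'.nat x = s.nat x) →
      e.val s' = n ∧ (s'.nat c 0 < n → v.val s' = w (s'.nat c 0))) :
    Runs (.forLt c e (.setNat a (.get c (.lit 0)) v)) s (n * 3 + 2) (fun s' =>
      s'.dat = s.dat ∧ (∀ x, x ≠ a → x ≠ c → s'.nat x = s.nat x) ∧
      ∀ i < n, s'.nat a i = w i) := by
  refine (Runs.forLt (T := 1) (fun k s' => s'.dat = s.dat ∧
      (∀ x, x ≠ a → x ≠ c → s'.nat x = s.nat x) ∧ s'.nat c 0 = k ∧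
      ∀ i < k, s'.nat a i = w i) n ?_ ?_ ?_).mono le_rfl ?_
  · rintro k s' - ⟨h1, h2, h3, h4⟩
    exact ⟨(hs s' h1 h2).1, h3⟩
  · rintro k s' hk ⟨h1, h2, h3, h4⟩
    apply Runs.setNat
    have hv := (hs s' h1 h2).2 (by omega)
    simp only [NExp.val, h3] at hv ⊢
    refine ⟨by simp [hac.symm, h3], by simpa using h1, ?_, by simp, ?_⟩
    · intro x hx hx'
      ext j
      simp [hx, hx', h2 x hx hx']
    · intro i hi
      by_cases hik : i = k
      · subst hik; simp [hac, hv]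
      · simp [hac, hik, h4 i (by omega)]
  · refine ⟨rfl, ?_, by simp, by simp⟩
    intro x hx hx'
    ext j
    simp [hx']
  · rintro s' ⟨h1, h2, h3, h4⟩
    exact ⟨h1, h2, h4⟩

/-- Filling a segment of an array of data, starting at cell `o`. -/
theorem Runs.fillDat {c a : ℕ} {e pos : NExp} {v : DExp} {s : Mem} (n o : ℕ) (w : ℕ → EReal)
    (hs : ∀ s' : Mem, (∀ x, x ≠ a → s'.dat x = s.dat x) → (∀ x, x ≠ c → s'.nat x = s.nat x) →
      e.val s' = n ∧ pos.val s' = o + s'.nat c 0 ∧ (s'.nat c 0 < n → v.val s' = w (s'.nat c 0))) :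
    Runs (.forLt c e (.setDat a pos v)) s (n * 3 + 2) (fun s' =>
      (∀ x, x ≠ a → s'.dat x = s.dat x) ∧ (∀ x, x ≠ c → s'.nat x = s.nat x) ∧
      (∀ i < o, s'.dat a i = s.dat a i) ∧ ∀ i < n, s'.dat a (o + i) = w i) := by
  refine (Runs.forLt (T := 1) (fun k s' => (∀ x, x ≠ a → s'.dat x = s.dat x) ∧
      (∀ x, x ≠ c → s'.nat x = s.nat x) ∧ s'.nat c 0 = k ∧
      (∀ i < o, s'.dat a i = s.dat a i) ∧ ∀ i < k, s'.dat a (o + i) = w i)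
      n ?_ ?_ ?_).mono le_rfl ?_
  · rintro k s' - ⟨h1, h2, h3, h4, h5⟩
    exact ⟨(hs s' h1 h2).1, h3⟩
  · rintro k s' hk ⟨h1, h2, h3, h4, h5⟩
    apply Runs.setDat
    obtain ⟨-, hp, hv⟩ := hs s' h1 h2
    rw [h3] at hv hp
    rw [hp, hv hk]
    refine ⟨by simpa using h3, ?_, ?_, by simp, ?_, ?_⟩
    · intro x hx
      ext j
      simp [hx, h1 x hx]
    · intro x hx
      ext j
      simp [hx, h2 x hx]
    · intro i hi
      have : i ≠ o + k := by omega
      simp [this, h4 i hi]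
    · intro i hi
      by_cases hik : i = k
      · subst hik; simp
      · simp [hik, h5 i (by omega)]
  · refine ⟨fun _ _ => rfl, ?_, by simp, by simp, by simp⟩
    intro x hx
    ext j
    simp [hx]
  · rintro s' ⟨h1, h2, h3, h4, h5⟩
    exact ⟨h1, h2, h4, h5⟩

/-- Computing a product by repeated addition. -/
theorem Runs.mulNat {c a : ℕ} {e v : NExp} {s : Mem} (m n : ℕ) (hac : a ≠ c)
    (hs : ∀ s' : Mem, (∀ x, x ≠ a → x ≠ c → s'.nat x = s.nat x) → e.val s' = m ∧ v.val s' = n) :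
    Runs (.seq (.setNat a (.lit 0) (.lit 0))
      (.forLt c e (.setNat a (.lit 0) (.add (.get a (.lit 0)) v)))) s (m * 3 + 3) (fun s' =>
      s'.dat = s.dat ∧ (∀ x, x ≠ a → x ≠ c → s'.nat x = s.nat x) ∧ s'.nat a 0 = m * n) := by
  refine (Runs.seq (T₁ := 1) (T₂ := m * 3 + 2) (P := fun s' => s'.dat = s.dat ∧
    (∀ x, x ≠ a → x ≠ c → s'.nat x = s.nat x) ∧ s'.nat a 0 = 0) (Runs.setNat ?_) ?_).mono
    (by omega) fun _ h => h
  · refine ⟨rfl, ?_, by simp [NExp.val]⟩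
    intro x hx hx'
    ext j
    simp [hx]
  rintro s₁ ⟨h₁, h₂, h₃⟩
  refine (Runs.forLt (T := 1) (fun k s' => s'.dat = s.dat ∧
      (∀ x, x ≠ a → x ≠ c → s'.nat x = s.nat x) ∧ s'.nat c 0 = k ∧
      s'.nat a 0 = k * n) m ?_ ?_ ?_).mono le_rfl ?_
  · rintro k s' - ⟨h1, h2, h3, h4⟩
    exact ⟨(hs s' h2).1, h3⟩
  · rintro k s' hk ⟨h1, h2, h3, h4⟩
    apply Runs.setNat
    have hv := (hs s' h2).2
    refine ⟨by simp [hac.symm, h3], by simpa using h1, ?_, by simp, ?_⟩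
    · intro x hx hx'
      ext j
      simp [hx, hx', h2 x hx hx']
    · simp [NExp.val, hac, hv, h4, add_mul]
  · refine ⟨h₁, ?_, by simp, by simp [hac, h₃]⟩
    intro x hx hx'
    ext j
    simp [hx', h₂ x hx hx']
  · rintro s' ⟨h1, h2, h3, h4⟩
    exact ⟨h1, h2, h4⟩

/-! ### Arrays that a program leaves alone -/

/-- A strict upper bound for the names of the arrays to which a program writes. -/
def Prog.bound : Prog → ℕ
  | .skip => 0
  | .setNat a _ _ => a + 1
  | .setDat a _ _ => a + 1
  | .seq p q => max p.bound q.bound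
  | .ite _ p q => max p.bound q.bound
  | .while _ p => p.bound

/-- A program changes only the arrays to which it writes. -/
theorem Exec.frame {p : Prog} {s s' : Mem} {t : ℕ} (h : Exec p s s' t) (a : ℕ)
    (ha : p.bound ≤ a) : s'.nat a = s.nat a ∧ s'.dat a = s.dat a := by
  induction h with
  | skip => exact ⟨rfl, rfl⟩
  | setNat s b pos val =>
    have : a ≠ b := by simp only [Prog.bound] at ha; omega
    exact ⟨by ext j; simp [this], rfl⟩
  | setDat s b pos val =>
    have : a ≠ b := by simp only [Prog.bound] at ha; omega
    exact ⟨rfl, by ext j; simp [this]⟩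
  | seq _ _ ih₁ ih₂ =>
    simp only [Prog.bound, max_le_iff] at ha
    have h₁ := ih₁ ha.1
    have h₂ := ih₂ ha.2
    exact ⟨h₂.1.trans h₁.1, h₂.2.trans h₁.2⟩
  | iteTrue _ _ ih =>
    simp only [Prog.bound, max_le_iff] at ha
    exact ih ha.1
  | iteFalse _ _ ih =>
    simp only [Prog.bound, max_le_iff] at ha
    exact ih ha.2
  | whileFalse => exact ⟨rfl, rfl⟩
  | whileTrue _ _ _ ih₁ ih₂ =>
    have h₁ := ih₁ ha
    have h₂ := ih₂ ha
    exact ⟨h₂.1.trans h₁.1, h₂.2.trans h₁.2⟩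

end RealRAM


/-! ### Positional number systems -/

theorem sum_digits_lt {b K : ℕ} {d : ℕ → ℕ} (hd : ∀ j < K, d j < b) :
    ∑ j ∈ Finset.range K, d j * b ^ j < b ^ K := by
  induction K with
  | zero => simp
  | succ K ih =>
    rw [Finset.sum_range_succ, pow_succ]
    have h₁ := ih fun j hj => hd j (by omega)
    have h₂ : (d K + 1) * b ^ K ≤ b * b ^ K := Nat.mul_le_mul_right _ (hd K (by omega))
    linarith

/-- Division by `b ^ K` isolates the leading digit, because the lower digits sum to less than `b ^
K`; induction handles the rest. -/
theorem digits_eq_of_sum_eq {b K : ℕ} {d d' : ℕ → ℕ} (hd : ∀ j < K, d j < b)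
    (hd' : ∀ j < K, d' j < b)
    (h : ∑ j ∈ Finset.range K, d j * b ^ j = ∑ j ∈ Finset.range K, d' j * b ^ j) :
    ∀ j < K, d j = d' j := by
  induction K with
  | zero => simp
  | succ K ih =>
    rw [Finset.sum_range_succ, Finset.sum_range_succ] at h
    have h₁ := sum_digits_lt fun j (hj : j < K) => hd j (by omega)
    have h₂ := sum_digits_lt fun j (hj : j < K) => hd' j (by omega)
    have hK : d K = d' K := by
      have h₃ := congrArg (· / b ^ K) h
      have hb : 0 < b ^ K := by omega
      simpa [Nat.add_mul_div_right, hb, Nat.div_eq_of_lt h₁, Nat.div_eq_of_lt h₂] using h₃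
    rw [hK] at h
    intro j hj
    rcases Nat.lt_succ_iff_lt_or_eq.1 hj with hj | rfl
    · exact ih (fun j hj => hd j (by omega)) (fun j hj => hd' j (by omega)) (by omega) j hj
    · exact hK

/-- The effect of overwriting one digit, in additive form to avoid subtraction in `ℕ`. -/
theorem sum_ite_digit {b N i v : ℕ} (d : ℕ → ℕ) (hi : i < N) :
    ∑ j ∈ Finset.range N, (if j = i then v else d j) * b ^ j + d i * b ^ i =
      ∑ j ∈ Finset.range N, d j * b ^ j + v * b ^ i := by
  rw [← Finset.add_sum_erase _ _ (Finset.mem_range.2 hi),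
    ← Finset.add_sum_erase _ (fun j => d j * b ^ j) (Finset.mem_range.2 hi)]
  have : ∑ j ∈ (Finset.range N).erase i, (if j = i then v else d j) * b ^ j =
      ∑ j ∈ (Finset.range N).erase i, d j * b ^ j :=
    Finset.sum_congr rfl fun j hj => by rw [if_neg (Finset.ne_of_mem_erase hj)]
  rw [this]
  simp only [if_true]
  ring

/-! ### A positional counter in memory -/

namespace RealRAM

/-- Adding one to the number whose digits are stored in the array `a`; the largest digit is one
more than cell `0` of the array `l`. -/
def Prog.increment (c l a : ℕ) : Prog :=
  .seq (.setNat c (.lit 0) (.lit 0)) (.seq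
    (.while (.natLt (.get l (.lit 0)) (.get a (.get c (.lit 0))))
      (.seq (.setNat a (.get c (.lit 0)) (.lit 0))
        (.setNat c (.lit 0) (.add (.get c (.lit 0)) (.lit 1)))))
    (.setNat a (.get c (.lit 0)) (.add (.get a (.get c (.lit 0))) (.lit 1))))

/-- During the carry, the stored number plus the pending carry `(M + 2) ^ i` stays equal to `k + 1`.
Since `k < (M + 2) ^ K`, the carry never passes position `K`. -/
theorem Runs.increment {c l a : ℕ} {s : Mem} {M K k : ℕ} (hca : c ≠ a) (hcl : c ≠ l) (hla : l ≠ a)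
    (hl : s.nat l 0 = M) (hd : ∀ j ≤ K, s.nat a j < M + 2)
    (hs : ∑ j ∈ Finset.range (K + 1), s.nat a j * (M + 2) ^ j = k) (hk : k < (M + 2) ^ K) :
    Runs (.increment c l a) s (K * 3 + 3) (fun s' => s'.dat = s.dat ∧
      (∀ x, x ≠ a → x ≠ c → s'.nat x = s.nat x) ∧ (∀ j ≤ K, s'.nat a j < M + 2) ∧
      ∑ j ∈ Finset.range (K + 1), s'.nat a j * (M + 2) ^ j = k + 1) := by
  let I : ℕ → Mem → Prop := fun i s' => s'.dat = s.dat ∧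
    (∀ x, x ≠ a → x ≠ c → s'.nat x = s.nat x) ∧ s'.nat c 0 = i ∧
    (∀ j ≤ K, s'.nat a j < M + 2) ∧
    ∑ j ∈ Finset.range (K + 1), s'.nat a j * (M + 2) ^ j + (M + 2) ^ i = k + 1
  refine (Runs.seq (T₁ := 1) (P := I 0) (Runs.setNat ?_) fun s₁ h₁ =>
    Runs.seq (Runs.while_le (T := 2) I K 0 (Nat.zero_le _) ?_ h₁) ?_ (T₂ := 1)).mono ?_
    fun _ h => h
  · refine ⟨rfl, ?_, by simp [NExp.val], ?_, ?_⟩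
    · intro x hx hx'
      ext j
      simp [hx']
    · simpa [hca.symm] using hd
    · simpa [hca.symm] using hs
  · rintro i s' ⟨h1, h2, h3, h4, h5⟩ hb
    have hl' : s'.nat l 0 = M := by rw [h2 l hla hcl.symm, hl]
    simp only [Test.Holds, NExp.val, h3, hl'] at hb
    -- A carry out of position `K` or beyond would make the invariant sum at least `2 * (M + 2) ^
    -- K`, more than `k + 1`. This uses that the base is at least 2.
    have hiK : i < K := by
      by_contra hi
      have : (M + 2) ^ K ≤ (M + 2) ^ i := Nat.pow_le_pow_right (by omega) (by omega)
      have hik : i = K := by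
        by_contra hne
        have : (M + 2) ^ (K + 1) ≤ (M + 2) ^ i := Nat.pow_le_pow_right (by omega) (by omega)
        have h6 : (M + 2) ^ K * 2 ≤ (M + 2) ^ (K + 1) := Nat.mul_le_mul_left _ (by omega)
        omega
      subst hik
      have h6 : s'.nat a i * (M + 2) ^ i ≤
          ∑ j ∈ Finset.range (i + 1), s'.nat a j * (M + 2) ^ j :=
        Finset.single_le_sum (f := fun j => s'.nat a j * (M + 2) ^ j)
          (fun _ _ => Nat.zero_le _) (by simp)
      have h7 : 1 * (M + 2) ^ i ≤ s'.nat a i * (M + 2) ^ i := Nat.mul_le_mul_right _ (by omega)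
      omega
    refine ⟨hiK, ?_⟩
    have hdi : s'.nat a i = M + 1 := by have := h4 i hiK.le; omega
    refine Runs.seq (P := fun s₂ => s₂ = s'.setNat a i 0) (T₁ := 1) (T₂ := 1)
      (Runs.setNat (by simp [NExp.val, h3])) ?_
    rintro _ rfl
    apply Runs.setNat
    refine ⟨h1, ?_, ?_, ?_, ?_⟩
    · intro x hx hx'
      ext j
      simp [hx, hx', h2 x hx hx']
    · simp [NExp.val, hca, h3]
    · intro j hj
      by_cases hji : j = i
      · simp [hca.symm, hji]
      · simpa [hca.symm, hji] using h4 j hj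
    · have := sum_ite_digit (b := M + 2) (v := 0) (s'.nat a) (show i < K + 1 by omega)
      simp only [hdi] at this
      simp only [Mem.setNat_nat, hca.symm, false_and, if_false, true_and]
      rw [pow_succ]
      linarith
  · rintro s' ⟨⟨i, hi, h1, h2, h3, h4, h5⟩, hb⟩
    have hl' : s'.nat l 0 = M := by rw [h2 l hla hcl.symm, hl]
    simp only [Test.Holds, NExp.val, h3, hl'] at hb
    apply Runs.setNat
    refine ⟨h1, ?_, ?_, ?_⟩
    · intro x hx hx'
      ext j
      simp [hx, h2 x hx hx']
    · intro j hj
      by_cases hji : j = i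
      · simp [NExp.val, h3, hji]; omega
      · simpa [NExp.val, h3, hji] using h4 j hj
    · have := sum_ite_digit (b := M + 2) (v := s'.nat a i + 1) (s'.nat a)
        (show i < K + 1 by omega)
      simp only [Mem.setNat_nat, NExp.val, h3, true_and]
      rw [add_mul] at this
      linarith
  · omega

end RealRAM

namespace SubgroupDiscovery

open RealRAM

/-! ### Candidate subgroups -/

/-- The `i`-th natural number in the encoding of a dataset. -/
def Dataset.natCell (D : Dataset) (i : ℕ) : ℕ := D.encodeNats.getD i 0

/-- The `i`-th data cell in the encoding of a dataset, and `⊤` behind the end of the encoding. -/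
noncomputable def Dataset.datCell (D : Dataset) (i : ℕ) : EReal := D.encodeData.getD i ⊤

theorem Dataset.length_encodeNats (D : Dataset) : D.encodeNats.length = D.m + 2 := by
  simp [Dataset.encodeNats]

theorem Dataset.length_encodeData (D : Dataset) : D.encodeData.length = D.m * D.n := by
  simp [Dataset.encodeData]

@[simp] theorem Dataset.natCell_zero (D : Dataset) : D.natCell 0 = D.m := rfl

@[simp] theorem Dataset.natCell_one (D : Dataset) : D.natCell 1 = D.n := rfl

theorem Dataset.natCell_target (D : Dataset) (i : Fin D.m) :
    D.natCell (2 + i) = (D.y i).toNat := by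
  have : 2 + (i : ℕ) = i + 1 + 1 := by omega
  simp [Dataset.natCell, Dataset.encodeNats, this]

theorem Dataset.datCell_of_le (D : Dataset) {i : ℕ} (h : D.m * D.n ≤ i) : D.datCell i = ⊤ :=
  List.getD_eq_default _ _ (by rwa [D.length_encodeData])

theorem Dataset.index_lt (D : Dataset) (i : Fin D.m) (j : Fin D.n) :
    (i * D.n + j : ℕ) < D.m * D.n := by
  have : ((i : ℕ) + 1) * D.n ≤ D.m * D.n := Nat.mul_le_mul_right _ i.2
  have := j.2
  rw [add_mul] at *
  omega

theorem Dataset.datCell_index (D : Dataset) (i : Fin D.m) (j : Fin D.n) :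
    D.datCell (i * D.n + j) = (D.X i j : EReal) := by
  have h := D.index_lt i j
  have hn : 0 < D.n := j.pos
  rw [Dataset.datCell, List.getD_eq_getElem _ _ (by rwa [D.length_encodeData])]
  simp only [Dataset.encodeData, List.getElem_ofFn]
  congr 2
  · ext
    simp [Fin.divNat, Nat.add_comm _ (j : ℕ), Nat.add_mul_div_right _ _ hn,
      Nat.div_eq_of_lt j.2]
  · ext
    simp [Fin.modNat, Nat.add_comm _ (j : ℕ), Nat.mod_eq_of_lt j.2]

/-- The subgroup whose bounds are the data cells with the addresses `d`. -/
noncomputable def Dataset.candidate (D : Dataset) (d : ℕ → ℕ) : Subgroup D.n where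
  lb j := D.datCell (d j)
  ub j := D.datCell (d (D.n + j))

theorem Dataset.candidate_congr (D : Dataset) {d d' : ℕ → ℕ}
    (h : ∀ j < D.n + D.n, d j = d' j) : D.candidate d = D.candidate d' := by
  simp only [Dataset.candidate, Subgroup.mk.injEq]
  constructor
  · ext j
    rw [h j (by omega)]
  · ext j
    rw [h (D.n + j) (by omega)]

/-- The members of a subgroup are the members of some candidate. -/
theorem Dataset.exists_candidate (D : Dataset) (S : Subgroup D.n) :
    ∃ d : ℕ → ℕ, (∀ j, d j < D.m * D.n + 2) ∧
      ∀ i, IsMember D (D.candidate d) i ↔ IsMember D S i := by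
  classical
  by_cases hS : ∃ i, IsMember D S i
  · have hne : (Finset.univ.filter fun i => IsMember D S i).Nonempty := by
      obtain ⟨i, hi⟩ := hS
      exact ⟨i, by simpa using hi⟩
    have hlo : ∀ j, ∃ i, IsMember D S i ∧ ∀ i', IsMember D S i' → D.X i j ≤ D.X i' j := by
      intro j
      simpa using Finset.exists_min_image _ (fun i => D.X i j) hne
    have hhi : ∀ j, ∃ i, IsMember D S i ∧ ∀ i', IsMember D S i' → D.X i' j ≤ D.X i j := by
      intro j
      simpa using Finset.exists_max_image _ (fun i => D.X i j) hne
    choose lo hlo hlo' using hlo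
    choose hi hhi hhi' using hhi
    -- Entry (i, j) has address `i * n + j`. Positions from `2n` on are never read; `0` is merely an
    -- address within the bound.
    let d : ℕ → ℕ := fun j => if h : j < D.n then lo ⟨j, h⟩ * D.n + j else
      if h : j - D.n < D.n then hi ⟨j - D.n, h⟩ * D.n + (j - D.n) else 0
    have hl : ∀ j, (D.candidate d).lb j = D.X (lo j) j := by
      intro j
      rw [← D.datCell_index]
      simp [Dataset.candidate, d]
    have hu : ∀ j, (D.candidate d).ub j = D.X (hi j) j := by
      intro j
      rw [← D.datCell_index]
      simp [Dataset.candidate, d]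
    refine ⟨d, ?_, ?_⟩
    · intro j
      simp only [d]
      split_ifs with h h
      · exact (D.index_lt _ ⟨j, h⟩).trans (by omega)
      · exact (D.index_lt _ ⟨j - D.n, h⟩).trans (by omega)
      · omega
    · intro i
      simp only [IsMember, hl, hu]
      constructor
      · intro h j
        -- The minimizer and the maximizer are themselves members of `S`, so the bounds of `S` are
        -- at least as wide as the tightened ones.
        exact ⟨(hlo j j).1.trans (h j).1, (h j).2.trans (hhi j j).2⟩
      · intro h j
        exact ⟨EReal.coe_le_coe_iff.2 (hlo' j i h), EReal.coe_le_coe_iff.2 (hhi' j i h)⟩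
  -- Address `mn` holds `⊤`, which exceeds every matrix entry. Membership in the candidate is
  -- refuted by deriving membership in `S` feature by feature, so that n = 0 needs no separate case.
  · refine ⟨fun _ => D.m * D.n, fun _ => Nat.lt_add_of_pos_right two_pos, fun i => ⟨fun h => ?_, fun h => (hS ⟨i, h⟩).elim⟩⟩
    refine (hS ⟨i, fun j => ?_⟩).elim
    have := (h j).1
    simp [Dataset.candidate, D.datCell_of_le le_rfl] at this

/-! ### Encodings as conditions on memory cells -/

theorem Dataset.stores_nats_iff (D : Dataset) (s : Mem) :
    (∀ (i : ℕ) (h : i < D.encodeNats.length), s.nat 0 i = D.encodeNats[i]) ↔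
      ∀ i < D.m + 2, s.nat 0 i = D.natCell i := by
  simp only [D.length_encodeNats]
  refine forall_congr' fun i => forall_congr' fun h => ?_
  rw [Dataset.natCell, List.getD_eq_getElem _ _ (by rwa [D.length_encodeNats])]

theorem Dataset.stores_iff (D : Dataset) (s : Mem) (Q : Quality) :
    s.Stores 0 ((discovery Q).encodeInst D) ↔
      (∀ i < D.m + 2, s.nat 0 i = D.natCell i) ∧ ∀ i < D.m * D.n, s.dat 0 i = D.datCell i := by
  refine and_congr (D.stores_nats_iff s) ?_
  simp only [discovery, D.length_encodeData]
  refine forall_congr' fun i => forall_congr' fun h => ?_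
  rw [Dataset.datCell, List.getD_eq_getElem _ _ (by rwa [D.length_encodeData])]

theorem Subgroup.stores_iff {n : ℕ} (S : Subgroup n) (f : ℕ → EReal) :
    (∀ (i : ℕ) (h : i < S.encodeData.length), f i = S.encodeData[i]) ↔
      ∀ j : Fin n, f j = S.lb j ∧ f (n + j) = S.ub j := by
  constructor
  · intro h j
    have h₁ := h j (by simp [Subgroup.encodeData]; omega)
    have h₂ := h (n + j) (by simp [Subgroup.encodeData])
    simp [Subgroup.encodeData] at h₁ h₂
    exact ⟨h₁, h₂⟩
  · intro h i hi
    simp only [Subgroup.encodeData, List.length_append, List.length_ofFn] at hi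
    simp only [Subgroup.encodeData, List.getElem_append, List.length_ofFn, List.getElem_ofFn]
    split_ifs with hin
    · exact (h ⟨i, hin⟩).1
    · have := (h ⟨i - n, by omega⟩).2
      simpa [Nat.add_sub_cancel' (not_lt.1 hin)] using this

theorem Dataset.stores_eval_iff (D : Dataset) (s : Mem) (Q : Quality) (S : Subgroup D.n) :
    s.Stores 0 ((evaluation Q).encodeInst ⟨D, S⟩) ↔
      (∀ i < D.m + 2, s.nat 0 i = D.natCell i) ∧ (∀ i < D.m * D.n, s.dat 0 i = D.datCell i) ∧
      ∀ j : Fin D.n, s.dat 0 (D.m * D.n + j) = S.lb j ∧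
        s.dat 0 (D.m * D.n + (D.n + j)) = S.ub j := by
  refine and_congr (D.stores_nats_iff s) ?_
  rw [← S.stores_iff fun i => s.dat 0 (D.m * D.n + i)]
  simp only [evaluation, List.length_append, D.length_encodeData]
  constructor
  · intro h
    constructor
    · intro i hi
      rw [h i (by omega), Dataset.datCell,
        List.getD_eq_getElem _ _ (by rwa [D.length_encodeData]), List.getElem_append_left]
    · intro i hi
      rw [h _ (by omega), List.getElem_append_right (by rw [D.length_encodeData]; omega)]
      simp [D.length_encodeData]
  · rintro ⟨h₁, h₂⟩ i hi
    by_cases hi' : i < D.m * D.n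
    · rw [h₁ i hi', Dataset.datCell,
        List.getD_eq_getElem _ _ (by rwa [D.length_encodeData]), List.getElem_append_left]
    · have := h₂ (i - D.m * D.n) (by omega)
      rw [Nat.add_sub_cancel' (not_lt.1 hi')] at this
      rw [this, List.getElem_append_right (by rw [D.length_encodeData]; omega)]
      simp [D.length_encodeData]

end SubgroupDiscovery

namespace SubgroupDiscovery

open RealRAM

/-! ### Exhaustive search over the candidates

The working memory of the search consists of arrays that the evaluating program leaves alone:
`b + 2` holds a copy of the dataset, `b + 3` the number of matrix entries (natural numbers) and the
best quality (data), `b + 4` a loop counter, `b + 5` the addresses of the bounds of the current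
candidate and `b + 6` those of the best candidate. -/

/-- The number of rows plus two. -/
def natLength (b : ℕ) : NExp := .add (.get (b + 2) (.lit 0)) (.lit 2)

/-- The number of matrix entries. -/
def entries (b : ℕ) : NExp := .get (b + 3) (.lit 0)

/-- The number of bounds of a subgroup. -/
def boundCount (b : ℕ) : NExp := .add (.get (b + 2) (.lit 1)) (.get (b + 2) (.lit 1))

/-- The loop counter. -/
def counter (b : ℕ) : NExp := .get (b + 4) (.lit 0)

/-- Copying the dataset to the working memory. -/
def saveProg (b : ℕ) : Prog :=
  .seq (.seq (.setNat (b + 3) (.lit 0) (.lit 0))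
      (.forLt (b + 4) (.get 0 (.lit 0)) (.setNat (b + 3) (.lit 0)
        (.add (.get (b + 3) (.lit 0)) (.get 0 (.lit 1)))))) <|
  .seq (.forLt (b + 4) (.add (.get 0 (.lit 0)) (.lit 2))
    (.setNat (b + 2) (counter b) (.get 0 (counter b)))) <|
  .seq (.forLt (b + 4) (entries b) (.setDat (b + 2) (counter b) (.get 0 (counter b)))) <|
  -- One infinite cell would suffice for the candidates; the second makes the base mn + 2 at least 2
  -- even for an empty matrix.
  .seq (.setDat (b + 2) (entries b) .top)
    (.setDat (b + 2) (.add (entries b) (.lit 1)) .top)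

/-- Evaluating the current candidate with the program `p`. -/
def evalProg (b : ℕ) (p : Prog) : Prog :=
  .seq (.forLt (b + 4) (natLength b) (.setNat 0 (counter b) (.get (b + 2) (counter b)))) <|
  .seq (.forLt (b + 4) (entries b) (.setDat 0 (counter b) (.get (b + 2) (counter b)))) <|
  .seq (.forLt (b + 4) (boundCount b) (.setDat 0 (.add (entries b) (counter b))
    (.get (b + 2) (.get (b + 5) (counter b))))) p

/-- Replacing the best candidate by the current one if the latter is at least as good. -/
def updateProg (b : ℕ) : Prog :=
  .ite (.datLe (.get (b + 3) (.lit 0)) (.get 1 (.lit 0)))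
    (.seq (.setDat (b + 3) (.lit 0) (.get 1 (.lit 0)))
      (.forLt (b + 4) (boundCount b) (.setNat (b + 6) (counter b) (.get (b + 5) (counter b)))))
    .skip

/-- The search over all candidates. -/
def searchProg (b : ℕ) (p : Prog) : Prog :=
  -- Every quality is a real number, so the first candidate always beats `⊥` and array `b + 6` is
  -- filled before it is read.
  .seq (.setDat (b + 3) (.lit 0) .bot) <|
  .seq (.forLt (b + 4) (.add (boundCount b) (.lit 1)) (.setNat (b + 5) (counter b) (.lit 0)))
    -- Digit number 2n is an overflow flag: it becomes positive exactly when all (mn + 2)^(2n)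
    -- candidates have been tried.
    (.while (.natLt (.get (b + 5) (boundCount b)) (.lit 1))
      (.seq (evalProg b p) (.seq (updateProg b) (.increment (b + 4) (b + 3) (b + 5)))))

/-- Subgroup discovery by exhaustive search. -/
def discoveryProg (b : ℕ) (p : Prog) : Prog :=
  .seq (saveProg b) <| .seq (searchProg b p)
    (.forLt (b + 4) (boundCount b) (.setDat 1 (counter b) (.get (b + 2) (.get (b + 6) (counter b)))))

/-- The working memory contains a copy of the dataset. -/
structure Saved (b : ℕ) (D : Dataset) (s : Mem) : Prop where
  nat : ∀ i < D.m + 2, s.nat (b + 2) i = D.natCell i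
  dat : ∀ i < D.m * D.n + 2, s.dat (b + 2) i = D.datCell i
  entries : s.nat (b + 3) 0 = D.m * D.n

namespace Saved

variable {b : ℕ} {D : Dataset} {s s' : Mem}

theorem congr (h : Saved b D s) (h₂ : s'.nat (b + 2) = s.nat (b + 2))
    (h₃ : s'.nat (b + 3) = s.nat (b + 3)) (hd : s'.dat (b + 2) = s.dat (b + 2)) :
    Saved b D s' :=
  ⟨by rw [h₂]; exact h.nat, by rw [hd]; exact h.dat, by rw [h₃]; exact h.entries⟩

theorem natLength_val (h : Saved b D s) : (natLength b).val s = D.m + 2 := by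
  simp [natLength, NExp.val, h.nat 0 (by omega)]

theorem entries_val (h : Saved b D s) : (SubgroupDiscovery.entries b).val s = D.m * D.n := by
  simp [SubgroupDiscovery.entries, NExp.val, h.entries]

theorem boundCount_val (h : Saved b D s) : (boundCount b).val s = D.n + D.n := by
  simp [boundCount, NExp.val, h.nat 1 (by omega)]

end Saved

theorem runs_saveProg {b : ℕ} {D : Dataset} {s : Mem} {Q : Quality}
    (hs : s.Stores 0 ((discovery Q).encodeInst D)) :
    Runs (saveProg b) s (6 * D.m + 3 * (D.m * D.n) + 15) (Saved b D) := by
  obtain ⟨hn, hd⟩ := (D.stores_iff s Q).1 hs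
  have h0 : s.nat 0 0 = D.m := hn 0 (by omega)
  have h1 : s.nat 0 1 = D.n := hn 1 (by omega)
  refine (Runs.seq (Runs.mulNat D.m D.n (by simp) ?_) fun s₁ ⟨d₁, n₁, v₁⟩ =>
    Runs.seq (Runs.fillNat (D.m + 2) D.natCell (by simp) ?_) fun s₂ ⟨d₂, n₂, v₂⟩ =>
    Runs.seq (Runs.fillDat (D.m * D.n) 0 D.datCell ?_) fun s₃ ⟨d₃, n₃, _, v₃⟩ =>
    Runs.seq (P := fun s₄ => s₄ = s₃.setDat (b + 2) (D.m * D.n) ⊤) (T₁ := 1) (T₂ := 1)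
      (Runs.setDat ?_) ?_).mono (by omega) fun _ h => h
  · intro s' h
    simp [NExp.val, h 0, h0, h1]
  · intro s' _ h
    have h0' : s'.nat 0 = s.nat 0 := by rw [h 0 (by simp) (by simp), n₁ 0 (by simp) (by simp)]
    refine ⟨by simp [NExp.val, h0', h0], fun hlt => ?_⟩
    simp only [NExp.val, counter, h0']
    exact hn _ hlt
  · intro s' hd' hn'
    refine ⟨?_, by simp [counter, NExp.val], fun hlt => ?_⟩
    · simp [NExp.val, entries, hn' (b + 3), n₂ (b + 3), v₁]
    · simp only [DExp.val, counter, NExp.val]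
      rw [hd' 0 (by simp), d₂, d₁, hd _ hlt]
  · simp [DExp.val, NExp.val, entries, n₃ (b + 3), n₂ (b + 3), v₁]
  · rintro _ rfl
    apply Runs.setDat
    have he : s₃.nat (b + 3) 0 = D.m * D.n := by rw [n₃ _ (by simp), n₂ _ (by simp) (by simp), v₁]
    refine ⟨fun i hi => ?_, fun i hi => ?_, he⟩
    · rw [← v₂ i hi, ← n₃ _ (by simp)]
      rfl
    · simp only [DExp.val, NExp.val, entries, Mem.setDat_dat, Mem.setDat_nat, he, true_and]
      split_ifs with h₁ h₂
      · rw [D.datCell_of_le (by omega)]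
      · rw [D.datCell_of_le (by omega)]
      · simpa using v₃ i (by omega)

/-- The input is rebuilt for every call because `p` may overwrite it. Leftovers of earlier calls do
no harm, since `p` is correct for arbitrary working memory. The arrays from `b + 2` on are out of
reach of `p` and also differ from the input array `0` and the output array `1`. -/
theorem runs_evalProg {b : ℕ} {p : Prog} {Q : Quality} {T : Polynomial ℕ} (hb : p.bound ≤ b)
    (hp : p.SolvesInTime (evaluation Q) fun x => T.eval ((evaluation Q).size x))
    {D : Dataset} {s : Mem} (hs : Saved b D s)
    (hd : ∀ j < D.n + D.n, s.nat (b + 5) j < D.m * D.n + 2) :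
    Runs (evalProg b p) s (3 * D.m + 3 * (D.m * D.n) + 6 * D.n + 12 +
        T.eval (2 + D.m + D.m * D.n + 2 * D.n)) (fun s' =>
      (∀ x, b + 2 ≤ x → x ≠ b + 4 → s'.nat x = s.nat x) ∧
      (∀ x, b + 2 ≤ x → s'.dat x = s.dat x) ∧
      s'.dat 1 0 = (Q D (D.candidate (s.nat (b + 5))) : EReal)) := by
  refine (Runs.seq (T₁ := (D.m + 2) * 3 + 2) (P := fun s₁ => Saved b D s₁ ∧
      (∀ x, b + 2 ≤ x → x ≠ b + 4 → s₁.nat x = s.nat x) ∧ (∀ x, b + 2 ≤ x → s₁.dat x = s.dat x) ∧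
      ∀ i < D.m + 2, s₁.nat 0 i = D.natCell i)
    ((Runs.fillNat (D.m + 2) D.natCell (by simp) ?_).mono le_rfl ?_) fun s₁ ⟨hs₁, n₁, d₁, v₁⟩ =>
    Runs.seq (T₁ := D.m * D.n * 3 + 2) (P := fun s₂ => Saved b D s₂ ∧
      (∀ x, x ≠ b + 4 → s₂.nat x = s₁.nat x) ∧ (∀ x, b + 2 ≤ x → s₂.dat x = s.dat x) ∧
      ∀ i < D.m * D.n, s₂.dat 0 i = D.datCell i)
    ((Runs.fillDat (D.m * D.n) 0 D.datCell ?_).mono le_rfl ?_) fun s₂ ⟨hs₂, n₂, d₂, v₂⟩ =>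
    Runs.seq (T₁ := (D.n + D.n) * 3 + 2)
      (T₂ := T.eval (2 + D.m + D.m * D.n + 2 * D.n))
      (Runs.fillDat (D.n + D.n) (D.m * D.n) (fun j => D.datCell (s.nat (b + 5) j)) ?_)
      fun s₃ ⟨d₃, n₃, f₃, v₃⟩ => ?_).mono (by omega) fun _ h => h
  · intro s' hd' hn'
    have hs' : Saved b D s' := hs.congr (hn' _ (by simp) (by simp)) (hn' _ (by simp) (by simp))
      (by rw [hd'])
    exact ⟨hs'.natLength_val, fun hlt => by simpa [NExp.val, counter] using hs'.nat _ hlt⟩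
  · rintro s₁ ⟨h₁, h₂, h₃⟩
    refine ⟨hs.congr (h₂ _ (by simp) (by simp)) (h₂ _ (by simp) (by simp)) (by rw [h₁]), ?_, ?_, h₃⟩
    · intro x hx hx'
      exact h₂ x (by omega) hx'
    · intro x _
      rw [h₁]
  · intro s' hd' hn'
    have hs' : Saved b D s' := hs₁.congr (hn' _ (by simp)) (hn' _ (by simp)) (hd' _ (by simp))
    refine ⟨hs'.entries_val, by simp [counter, NExp.val], fun hlt => ?_⟩
    simpa [DExp.val, NExp.val, counter] using hs'.dat _ (hlt.trans (by simp))
  · rintro s₂ ⟨h₁, h₂, -, h₃⟩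
    refine ⟨hs₁.congr (h₂ _ (by simp)) (h₂ _ (by simp)) (h₁ _ (by simp)), h₂, ?_, by simpa using h₃⟩
    intro x hx
    rw [h₁ x (by omega), d₁ x hx]
  · intro s' hd' hn'
    have hs' : Saved b D s' := hs₂.congr (hn' _ (by simp)) (hn' _ (by simp)) (hd' _ (by simp))
    have h5 : s'.nat (b + 5) = s.nat (b + 5) := by
      rw [hn' _ (by simp), n₂ _ (by simp), n₁ _ (by simp) (by simp)]
    refine ⟨hs'.boundCount_val, ?_, fun hlt => ?_⟩
    · have := hs'.entries_val
      simp only [NExp.val, this, counter]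
    · simp only [DExp.val, NExp.val, counter, h5]
      exact hs'.dat _ (hd _ hlt)
  · have hst : s₃.Stores 0 ((evaluation Q).encodeInst ⟨D, D.candidate (s.nat (b + 5))⟩) := by
      refine (D.stores_eval_iff s₃ Q _).2 ⟨fun i hi => ?_, fun i hi => ?_, fun j => ⟨?_, ?_⟩⟩
      · rw [n₃ _ (by simp), n₂ _ (by simp), v₁ i hi]
      · rw [f₃ i hi, v₂ i hi]
      · exact v₃ j (by omega)
      · exact v₃ (D.n + j) (by omega)
    obtain ⟨s', t, z, he, ht, hz, -, hz'⟩ := hp _ s₃ hst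
    refine ⟨s', t, he, ht.trans (le_of_eq ?_), fun x hx hx' => ?_, fun x hx => ?_, ?_⟩
    · dsimp only
      congr 1
      simp [Problem.size, Word.size, evaluation, D.length_encodeNats, D.length_encodeData,
        Subgroup.encodeData]
      ring
    · rw [(he.frame x (by omega)).1, n₃ x hx', n₂ x hx', n₁ x hx hx']
    · rw [(he.frame x (by omega)).2, d₃ x (by omega), d₂ x hx]
    · have hz : z = Q D (D.candidate (s.nat (b + 5))) := hz
      rw [← hz]
      exact hz' 0 (by simp [evaluation])

/-- The invariant of the search: `k` candidates have been evaluated. -/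
structure Searched (b : ℕ) (Q : Quality) (D : Dataset) (k : ℕ) (s : Mem) : Prop where
  saved : Saved b D s
  digit_lt : ∀ j ≤ D.n + D.n, s.nat (b + 5) j < D.m * D.n + 2
  sum_digits : ∑ j ∈ Finset.range (D.n + D.n + 1),
    s.nat (b + 5) j * (D.m * D.n + 2) ^ j = k
  le_best : ∀ d : ℕ → ℕ, (∀ j < D.n + D.n, d j < D.m * D.n + 2) →
    ∑ j ∈ Finset.range (D.n + D.n), d j * (D.m * D.n + 2) ^ j < k →
      (Q D (D.candidate d) : EReal) ≤ s.dat (b + 3) 0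
  init : k = 0 → s.dat (b + 3) 0 = ⊥
  best : 0 < k → s.dat (b + 3) 0 = Q D (D.candidate (s.nat (b + 6))) ∧
    ∀ j < D.n + D.n, s.nat (b + 6) j < D.m * D.n + 2

theorem runs_updateProg {b : ℕ} {D : Dataset} {s : Mem} (hs : Saved b D s) :
    Runs (updateProg b) s (6 * D.n + 4) (fun s' =>
      (∀ x, b + 2 ≤ x → x ≠ b + 4 → x ≠ b + 6 → s'.nat x = s.nat x) ∧
      s'.dat (b + 2) = s.dat (b + 2) ∧ s'.dat (b + 3) 0 = max (s.dat (b + 3) 0) (s.dat 1 0) ∧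
      (s.dat (b + 3) 0 ≤ s.dat 1 0 → ∀ j < D.n + D.n, s'.nat (b + 6) j = s.nat (b + 5) j) ∧
      (s.dat 1 0 < s.dat (b + 3) 0 → s'.nat (b + 6) = s.nat (b + 6))) := by
  refine (Runs.ite (T := 6 * D.n + 3) (fun h => ?_) fun h => ?_).mono le_rfl fun _ h => h
  · have hle : s.dat (b + 3) 0 ≤ s.dat 1 0 := h
    refine (Runs.seq (P := fun s₁ => s₁ = s.setDat (b + 3) 0 (s.dat 1 0)) (Runs.setDat ?_) ?_
      (T₁ := 1) (T₂ := (D.n + D.n) * 3 + 2)).mono (by omega) fun _ h => h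
    · simp [NExp.val, DExp.val]
    · rintro _ rfl
      refine (Runs.fillNat (D.n + D.n) (s.nat (b + 5)) (by simp) ?_).mono le_rfl ?_
      · intro s' hd' hn'
        have hs' : Saved b D s' := hs.congr (hn' _ (by simp) (by simp)) (hn' _ (by simp) (by simp))
          (by ext; simp [hd'])
        refine ⟨hs'.boundCount_val, fun _ => ?_⟩
        simp [NExp.val, counter, hn' (b + 5)]
      · rintro s' ⟨h₁, h₂, h₃⟩
        refine ⟨fun x _ hx hx' => h₂ x hx' hx, by ext; simp [h₁], by simp [h₁, hle], fun _ => h₃,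
          fun hlt => (hle.not_gt hlt).elim⟩
  · have hlt : s.dat 1 0 < s.dat (b + 3) 0 := not_le.1 h
    exact (Runs.skip ⟨fun _ _ _ _ => rfl, rfl, (max_eq_left hlt.le).symm,
      fun h => (hlt.not_ge h).elim, fun _ => rfl⟩).mono (by omega) fun _ h => h

theorem runs_searchStep {b : ℕ} {p : Prog} {Q : Quality} {T : Polynomial ℕ} (hb : p.bound ≤ b)
    (hp : p.SolvesInTime (evaluation Q) fun x => T.eval ((evaluation Q).size x))
    {D : Dataset} {s : Mem} {k : ℕ} (hk : k < (D.m * D.n + 2) ^ (D.n + D.n))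
    (h : Searched b Q D k s) :
    Runs (.seq (evalProg b p) (.seq (updateProg b) (.increment (b + 4) (b + 3) (b + 5)))) s
      (3 * D.m + 3 * (D.m * D.n) + 18 * D.n + 19 + T.eval (2 + D.m + D.m * D.n + 2 * D.n))
      (Searched b Q D (k + 1)) := by
  refine (Runs.seq (runs_evalProg hb hp h.saved fun j hj => h.digit_lt j hj.le)
    (fun s₁ ⟨n₁, d₁, v₁⟩ => ?_) (T₂ := 12 * D.n + 7)).mono (by omega) fun _ h => h
  have hs₁ : Saved b D s₁ := h.saved.congr (n₁ _ (by simp) (by simp)) (n₁ _ (by simp) (by simp))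
    (d₁ _ (by simp))
  refine (Runs.seq (runs_updateProg hs₁) fun s₂ ⟨n₂, d₂, e₂, f₂, g₂⟩ =>
    (Runs.increment (K := D.n + D.n) (k := k) (M := D.m * D.n) (by simp) (by simp) (by simp)
      ?_ ?_ ?_ hk).mono le_rfl (Q := Searched b Q D (k + 1)) ?_).mono (by omega) fun _ h => h
  · rw [n₂ _ (by simp) (by simp) (by simp), hs₁.entries]
  · rw [n₂ _ (by simp) (by simp) (by simp), n₁ _ (by simp) (by simp)]
    exact h.digit_lt
  · rw [n₂ _ (by simp) (by simp) (by simp), n₁ _ (by simp) (by simp)]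
    exact h.sum_digits
  · rintro s₃ ⟨d₃, n₃, l₃, v₃⟩
    have h3 : s₃.dat (b + 3) 0 =
        max (s.dat (b + 3) 0) (Q D (D.candidate (s.nat (b + 5))) : EReal) := by
      rw [d₃, e₂, v₁, d₁ _ (by simp)]
    refine ⟨hs₁.congr ?_ ?_ ?_, l₃, v₃, ?_, by simp, ?_⟩
    · rw [n₃ _ (by simp) (by simp), n₂ _ (by simp) (by simp) (by simp)]
    · rw [n₃ _ (by simp) (by simp), n₂ _ (by simp) (by simp) (by simp)]
    · rw [d₃, d₂]
    · intro d hd hlt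
      rw [h3]
      rcases Nat.lt_succ_iff_lt_or_eq.1 hlt with hlt | heq
      · exact (h.le_best d hd hlt).trans (le_max_left _ _)
      -- A candidate with number `k` is the current one: the overflow digit is still 0, and digits
      -- are unique.
      · have hsum := h.sum_digits
        rw [Finset.sum_range_succ] at hsum
        have h0 : s.nat (b + 5) (D.n + D.n) = 0 := by
          by_contra h0
          have := Nat.le_mul_of_pos_left ((D.m * D.n + 2) ^ (D.n + D.n)) (Nat.pos_of_ne_zero h0)
          omega
        rw [h0, zero_mul, add_zero, ← heq] at hsum
        rw [D.candidate_congr (digits_eq_of_sum_eq hd (fun j hj => h.digit_lt j hj.le) hsum.symm)]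
        exact le_max_right _ _
    · intro _
      have h6 : s₃.nat (b + 6) = s₂.nat (b + 6) := n₃ _ (by simp) (by simp)
      rw [h3, h6]
      rw [v₁, d₁ _ (by simp), n₁ (b + 5) (by simp) (by simp)] at f₂
      rw [v₁, d₁ _ (by simp), n₁ (b + 6) (by simp) (by simp)] at g₂
      rcases le_or_gt (s.dat (b + 3) 0) (Q D (D.candidate (s.nat (b + 5))) : EReal) with hle | hlt
      · rw [max_eq_right hle, D.candidate_congr (f₂ hle)]
        refine ⟨rfl, fun j hj => ?_⟩
        rw [f₂ hle j hj]
        exact h.digit_lt j hj.le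
      · rw [max_eq_left hlt.le, g₂ hlt]
        -- Keeping the old best is impossible in the first round, when the stored value is `⊥`.
        rcases Nat.eq_zero_or_pos k with rfl | hk0
        · rw [h.init rfl] at hlt
          exact (not_lt_bot hlt).elim
        · exact h.best hk0

theorem runs_searchProg {b : ℕ} {p : Prog} {Q : Quality} {T : Polynomial ℕ} (hb : p.bound ≤ b)
    (hp : p.SolvesInTime (evaluation Q) fun x => T.eval ((evaluation Q).size x))
    {D : Dataset} {s : Mem} (hs : Saved b D s) :
    Runs (searchProg b p) s ((D.m * D.n + 2) ^ (D.n + D.n) *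
        (3 * D.m + 3 * (D.m * D.n) + 18 * D.n + 20 +
          T.eval (2 + D.m + D.m * D.n + 2 * D.n)) + 6 * D.n + 7)
      (Searched b Q D ((D.m * D.n + 2) ^ (D.n + D.n))) := by
  refine (Runs.seq (T₁ := 1) (P := fun s₁ => s₁ = s.setDat (b + 3) 0 ⊥)
    (Runs.setDat (by simp [NExp.val, DExp.val])) ?_
    (T₂ := (D.n + D.n + 1) * 3 + 2 + ((D.m * D.n + 2) ^ (D.n + D.n) *
      (3 * D.m + 3 * (D.m * D.n) + 18 * D.n + 19 + T.eval (2 + D.m + D.m * D.n + 2 * D.n) + 1)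
      + 1))).mono ?_ fun _ h => h
  · rintro _ rfl
    refine Runs.seq ((Runs.fillNat (D.n + D.n + 1) (fun _ => 0) (by simp) ?_).mono le_rfl
      (Q := Searched b Q D 0) ?_) fun s₂ hs₂ => Runs.while_eq _ _ ?_ ?_ hs₂
    · intro s' hd' hn'
      have hs' : Saved b D s' := hs.congr (hn' _ (by simp) (by simp)) (hn' _ (by simp) (by simp))
        (by ext; simp [hd'])
      have := hs'.boundCount_val
      simp [NExp.val, this]
    · rintro s₁ ⟨hd', hn', h⟩
      refine ⟨hs.congr (hn' _ (by simp) (by simp)) (hn' _ (by simp) (by simp))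
        (by ext; simp [hd']), fun j hj => ?_, ?_, by simp, by simp [hd'], by simp⟩
      · rw [h j (by omega)]
        omega
      · refine Finset.sum_eq_zero fun j hj => ?_
        rw [h j (Finset.mem_range.1 hj), zero_mul]
    -- The lower 2n digits contribute less than `(mn + 2) ^ (2n)`, so the overflow digit is 0 if and
    -- only if `k` is below this power.
    · intro k s' hk h
      have hsum := h.sum_digits
      have hlt := sum_digits_lt fun j (hj : j < D.n + D.n) => h.digit_lt j hj.le
      rw [Finset.sum_range_succ] at hsum
      have hb := h.saved.boundCount_val
      simp only [Test.Holds, NExp.val, hb, Nat.lt_one_iff]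
      constructor
      · intro h0
        rw [h0] at hsum
        omega
      · intro hk
        by_contra h0
        have := Nat.le_mul_of_pos_left ((D.m * D.n + 2) ^ (D.n + D.n)) (Nat.pos_of_ne_zero h0)
        omega
    · exact fun k s' hk h => runs_searchStep hb hp hk h
  · apply le_of_eq
    ring

theorem solves_discoveryProg {b : ℕ} {p : Prog} {Q : Quality} {T : Polynomial ℕ}
    (hQ : Q.DependsOnMembers) (hb : p.bound ≤ b)
    (hp : p.SolvesInTime (evaluation Q) fun x => T.eval ((evaluation Q).size x)) :
    (discoveryProg b p).SolvesInTime (discovery Q) fun D =>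
      (D.m * D.n + 2) ^ (D.n + D.n) * (3 * D.m + 3 * (D.m * D.n) + 18 * D.n + 20 +
          T.eval (2 + D.m + D.m * D.n + 2 * D.n)) +
        (6 * D.m + 3 * (D.m * D.n) + 12 * D.n + 24) := by
  intro D s hs
  obtain ⟨s', t, he, ht, hst, hbest⟩ := Runs.seq (runs_saveProg (b := b) hs) fun s₁ h₁ =>
    Runs.seq (runs_searchProg hb hp h₁) fun s₂ h₂ =>
    (Runs.fillDat (a := 1) (c := b + 4) (e := boundCount b) (pos := counter b)
      (v := .get (b + 2) (.get (b + 6) (counter b))) (D.n + D.n) 0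
      (fun j => D.datCell (s₂.nat (b + 6) j)) (by
        intro s' hd hn
        have hsv : Saved b D s' := h₂.saved.congr (hn _ (by simp)) (hn _ (by simp))
          (hd _ (by simp))
        refine ⟨hsv.boundCount_val, by simp [counter, NExp.val], fun hlt => ?_⟩
        simp only [DExp.val, counter, NExp.val]
        rw [hn (b + 6) (by simp), hsv.dat _ ((h₂.best (by positivity)).2 _ hlt)])).mono
      (Q := fun s' => ∃ d, (∀ S', Q D S' ≤ Q D (D.candidate d)) ∧
        ∀ j < D.n + D.n, s'.dat 1 j = D.datCell (d j)) le_rfl (by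
        rintro s' ⟨-, -, -, h⟩
        refine ⟨s₂.nat (b + 6), fun S' => ?_, by simpa using h⟩
        -- An arbitrary subgroup has the quality of some candidate, whose number is below `(mn + 2)
        -- ^ (2n)` and which has therefore been compared with the best one.
        obtain ⟨d, hd, hmem⟩ := D.exists_candidate S'
        rw [← hQ D _ S' hmem]
        have := h₂.le_best d (fun j _ => hd j) (sum_digits_lt fun j _ => hd j)
        rwa [(h₂.best (by positivity)).1, EReal.coe_le_coe_iff] at this)
  obtain ⟨hmax, hd⟩ := hbest
  -- `hst` is the address list of the best candidate.
  refine ⟨s', t, D.candidate hst, he, ht.trans (by dsimp only; omega), hmax, ?_, ?_⟩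
  · simp [discovery]
  · refine (Subgroup.stores_iff _ (s'.dat 1)).2 fun j => ⟨hd j (by omega), hd _ (by omega)⟩

end SubgroupDiscovery

/-! ### From the running time to XP -/

namespace SubgroupDiscovery

open RealRAM

theorem eval_le_of_one_le (T : Polynomial ℕ) {x : ℕ} (hx : 1 ≤ x) :
    T.eval x ≤ T.eval 1 * x ^ T.natDegree := by
  rw [Polynomial.eval_eq_sum_range, Polynomial.eval_eq_sum_range, Finset.sum_mul]
  refine Finset.sum_le_sum fun i hi => ?_
  rw [one_pow, mul_one]
  exact Nat.mul_le_mul_left _ (Nat.pow_le_pow_right hx (by simpa [Nat.lt_succ_iff] using hi))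

theorem eval_mono (T : Polynomial ℕ) {x y : ℕ} (h : x ≤ y) : T.eval x ≤ T.eval y := by
  rw [Polynomial.eval_eq_sum_range, Polynomial.eval_eq_sum_range]
  exact Finset.sum_le_sum fun i _ => Nat.mul_le_mul_left _ (Nat.pow_le_pow_left h i)

/-- With `N` the instance size, `W = N * (2 * n + 1)` dominates the size `N + 2 * n` of every
evaluation input. It separates into a power of `N` and a factor depending only on `n`. The exponent
`e + 1` instead of `e` lets `W ^ (e + 1)` absorb the linear terms even if `T` is constant. -/
theorem search_time_le (T : Polynomial ℕ) (m n M : ℕ) :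
    (M + 2) ^ (n + n) * (3 * m + 3 * M + 18 * n + 20 + T.eval (2 + m + M + 2 * n)) +
        (6 * m + 3 * M + 12 * n + 24) ≤
      (40 + T.eval 1) * (2 * n + 1) ^ (T.natDegree + 1) *
        (m + 2 + M) ^ (2 * n + T.natDegree + 1) := by
  set N := m + 2 + M with hN
  set e := T.natDegree
  have hW : N + 2 * n ≤ N * (2 * n + 1) := by
    have := Nat.le_mul_of_pos_left (2 * n) (show 0 < N by omega)
    rw [mul_add]
    omega
  set W := N * (2 * n + 1)
  have hW1 : 1 ≤ W := by omega
  have hT : T.eval (2 + m + M + 2 * n) ≤ T.eval 1 * W ^ (e + 1) :=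
    (eval_mono T (by omega)).trans ((eval_le_of_one_le T hW1).trans
      (Nat.mul_le_mul_left _ (Nat.pow_le_pow_right hW1 (Nat.le_succ _))))
  have hWe : W ≤ W ^ (e + 1) := Nat.le_self_pow (by omega) W
  have hpow : (M + 2) ^ (n + n) ≤ N ^ (n + n) := Nat.pow_le_pow_left (by omega) _
  have hN1 : 1 ≤ N ^ (n + n) := Nat.one_le_pow _ _ (by omega)
  calc _ ≤ N ^ (n + n) * (20 * W ^ (e + 1) + T.eval 1 * W ^ (e + 1)) +
        1 * (20 * W ^ (e + 1)) := by
        refine Nat.add_le_add (Nat.mul_le_mul hpow (Nat.add_le_add ?_ hT)) ?_ <;> omega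
    _ ≤ N ^ (n + n) * (20 * W ^ (e + 1) + T.eval 1 * W ^ (e + 1)) +
        N ^ (n + n) * (20 * W ^ (e + 1)) := Nat.add_le_add_left (Nat.mul_le_mul_right _ hN1) _
    _ = _ := by simp only [W, mul_pow]; ring

/-- Subgroup discovery is in XP for the number of features. -/
theorem discovery_inXP {Q : Quality} (hQ : Q.DependsOnMembers) (h : (evaluation Q).InPolyTime) :
    (discovery Q).InXP fun D : Dataset => D.n := by
  obtain ⟨p, T, hp⟩ := h
  refine ⟨discoveryProg p.bound p, fun n => (40 + T.eval 1) * (2 * n + 1) ^ (T.natDegree + 1),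
    fun n => 2 * n + T.natDegree + 1, ?_, ?_, ?_⟩
  · have hpow : Primrec₂ fun a b : ℕ => a ^ b := Primrec₂.unpaired'.1 Nat.Primrec.pow
    exact (Primrec.nat_mul.comp (Primrec.const _) (hpow.comp (Primrec.nat_add.comp
      (Primrec.nat_mul.comp (Primrec.const 2) Primrec.id) (Primrec.const 1))
      (Primrec.const _))).to_comp
  · exact (Primrec.nat_add.comp (Primrec.nat_add.comp
      (Primrec.nat_mul.comp (Primrec.const 2) Primrec.id) (Primrec.const _))
      (Primrec.const 1)).to_comp
  · intro (D : Dataset) s hs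
    obtain ⟨s', t, z, he, ht, h⟩ := solves_discoveryProg hQ le_rfl hp D s hs
    refine ⟨s', t, z, he, ht.trans ?_, h⟩
    have := search_time_le T D.m D.n (D.m * D.n)
    have hsize : (discovery Q).size D = D.m + 2 + D.m * D.n := by
      simp [Problem.size, Word.size, discovery, D.length_encodeNats, D.length_encodeData]
    rw [← hsize] at this
    exact this

/-! ### Weighted Relative Accuracy -/

theorem wracc_dependsOnMembers : Quality.DependsOnMembers wracc := by
  intro D S S' h
  simp only [wracc, h]

/-- Clearing the flag in cell `0` of the array `a` unless a test holds. -/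
theorem runs_check {a : ℕ} {b : Test} (s : Mem) :
    Runs (.ite b .skip (.setNat a (.lit 0) (.lit 0))) s 2 (fun s' => s'.dat = s.dat ∧
      (∀ x, x ≠ a → s'.nat x = s.nat x) ∧ (b.Holds s → s'.nat a 0 = s.nat a 0) ∧
      (¬ b.Holds s → s'.nat a 0 = 0)) := by
  refine Runs.ite (fun h => Runs.skip ⟨rfl, fun _ _ => rfl, fun _ => rfl, fun h' => (h' h).elim⟩)
    fun h => Runs.setNat ⟨rfl, fun x hx => ?_, fun h' => (h h').elim, fun _ => ?_⟩
  · ext j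
    simp [hx]
  · simp [NExp.val]

/-- The test whether a data object is a member of the subgroup, where array `5` holds the address
of the next matrix entry, and the result is stored in array `6`. -/
def memberProg : Prog :=
  .seq (.setNat 6 (.lit 0) (.lit 1)) <|
  .forLt 4 (.get 0 (.lit 1)) <|
  .seq (.ite (.datLe (.get 0 (.add (.get 2 (.lit 0)) (.get 4 (.lit 0))))
    (.get 0 (.get 5 (.lit 0)))) .skip (.setNat 6 (.lit 0) (.lit 0))) <|
  .seq (.ite (.datLe (.get 0 (.get 5 (.lit 0)))
    (.get 0 (.add (.get 2 (.lit 0)) (.add (.get 0 (.lit 1)) (.get 4 (.lit 0)))))) .skip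
      (.setNat 6 (.lit 0) (.lit 0)))
    (.setNat 5 (.lit 0) (.add (.get 5 (.lit 0)) (.lit 1)))

/-- Computation of the Weighted Relative Accuracy of a given subgroup. -/
def wraccProg : Prog :=
  .seq (.seq (.setNat 2 (.lit 0) (.lit 0))
    (.forLt 3 (.get 0 (.lit 0)) (.setNat 2 (.lit 0) (.add (.get 2 (.lit 0)) (.get 0 (.lit 1)))))) <|
  .seq (.setNat 5 (.lit 0) (.lit 0)) <|
  .seq (.setNat 7 (.lit 0) (.lit 0)) <|
  .seq (.setNat 8 (.lit 0) (.lit 0)) <|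
  .seq (.setNat 9 (.lit 0) (.lit 0)) <|
  .seq (.forLt 3 (.get 0 (.lit 0)) <|
    .seq memberProg <|
    .seq (.setNat 7 (.lit 0) (.add (.get 7 (.lit 0)) (.get 6 (.lit 0)))) <|
    .seq (.setNat 8 (.lit 0) (.add (.get 8 (.lit 0)) (.get 0 (.add (.lit 2) (.get 3 (.lit 0))))))
      (.setNat 9 (.lit 0) (.add (.get 9 (.lit 0))
        (.sub (.add (.get 0 (.add (.lit 2) (.get 3 (.lit 0)))) (.get 6 (.lit 0))) (.lit 1)))))
    (.setDat 1 (.lit 0) (.mul (.div (.ofNat (.get 7 (.lit 0))) (.ofNat (.get 0 (.lit 0))))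
      (.sub (.div (.ofNat (.get 9 (.lit 0))) (.ofNat (.get 7 (.lit 0))))
        (.div (.ofNat (.get 8 (.lit 0))) (.ofNat (.get 0 (.lit 0)))))))

open Classical in
theorem runs_memberProg {D : Dataset} {S : Subgroup D.n} {s : Mem} (i : Fin D.m)
    (hn : s.nat 0 1 = D.n) (hM : s.nat 2 0 = D.m * D.n) (h5 : s.nat 5 0 = i * D.n)
    (hX : ∀ j : Fin D.n, s.dat 0 (i * D.n + j) = D.X i j)
    (hS : ∀ j : Fin D.n, s.dat 0 (D.m * D.n + j) = S.lb j ∧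
      s.dat 0 (D.m * D.n + (D.n + j)) = S.ub j) :
    Runs memberProg s (D.n * 7 + 3) (fun s' => s'.dat = s.dat ∧
      (∀ x, x ≠ 4 → x ≠ 5 → x ≠ 6 → s'.nat x = s.nat x) ∧
      s'.nat 5 0 = (i + 1) * D.n ∧ s'.nat 6 0 = if IsMember D S i then 1 else 0) := by
  refine (Runs.seq (T₁ := 1) (P := fun s₁ => s₁ = s.setNat 6 0 1)
    (Runs.setNat (by simp [NExp.val])) ?_ (T₂ := D.n * (5 + 2) + 2)).mono (by omega) fun _ h => h
  rintro _ rfl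
  refine (Runs.forLt (fun k s' => s'.dat = s.dat ∧
      (∀ x, x ≠ 4 → x ≠ 5 → x ≠ 6 → s'.nat x = s.nat x) ∧ s'.nat 4 0 = k ∧
      -- The entry address runs on from row to row, so no multiplication is needed to find the start
      -- of a row.
      s'.nat 5 0 = i * D.n + k ∧
      s'.nat 6 0 = if ∀ j : Fin D.n, j < k → (D.X i j : EReal) ≥ S.lb j ∧ D.X i j ≤ S.ub j
        then 1 else 0) D.n ?_ ?_ ?_).mono le_rfl ?_
  · rintro k s' - ⟨-, h2, h3, -⟩
    exact ⟨by simp [NExp.val, h2 0, hn], h3⟩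
  · rintro k s' hk ⟨h1, h2, h3, h4, h6⟩
    have hx := hX ⟨k, hk⟩
    obtain ⟨hl, hu⟩ := hS ⟨k, hk⟩
    refine Runs.seq (T₂ := 3) (runs_check s') fun s₁ ⟨d₁, n₁, t₁, f₁⟩ => Runs.seq (runs_check s₁)
      (fun s₂ ⟨d₂, n₂, t₂, f₂⟩ => Runs.setNat ?_) (T₂ := 1)
    have e0 : s₁.nat 0 1 = D.n := by rw [n₁ 0 (by simp), h2 0 (by simp) (by simp) (by simp), hn]
    have e2 : s'.nat 2 0 = D.m * D.n := by rw [h2 2 (by simp) (by simp) (by simp), hM]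
    simp only at hx hl hu
    simp only [Test.Holds, DExp.val, NExp.val, n₁ 2 (by simp), n₁ 4 (by simp), n₁ 5 (by simp),
      d₁, h1, h3, h4, e0, e2, hx, hl, hu] at t₁ f₁ t₂ f₂
    refine ⟨by simp [n₂ 4, n₁ 4, h3], by simp [d₂, d₁, h1], ?_, by simp, ?_, ?_⟩
    · intro x hx hx' hx''
      ext j
      simp [hx, hx', n₂ x hx'', n₁ x hx'', h2 x hx hx' hx'']
    · simp [NExp.val, n₂ 5, n₁ 5, h4, add_assoc]
    · have hiff : (∀ j : Fin D.n, (j : ℕ) < k + 1 →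
          (D.X i j : EReal) ≥ S.lb j ∧ (D.X i j : EReal) ≤ S.ub j) ↔
          (∀ j : Fin D.n, (j : ℕ) < k →
            (D.X i j : EReal) ≥ S.lb j ∧ (D.X i j : EReal) ≤ S.ub j) ∧
          S.lb ⟨k, hk⟩ ≤ D.X i ⟨k, hk⟩ ∧ D.X i ⟨k, hk⟩ ≤ S.ub ⟨k, hk⟩ := by
        constructor
        · exact fun h => ⟨fun j hj => h j (by omega), h ⟨k, hk⟩ (by simp)⟩
        · rintro ⟨h, h'⟩ j hj
          rcases Nat.lt_succ_iff_lt_or_eq.1 hj with hj | hj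
          · exact h j hj
          · obtain rfl : j = ⟨k, hk⟩ := Fin.ext hj
            exact h'
      simp only [hiff, Mem.setNat_nat, NExp.val]
      by_cases hu' : D.X i ⟨k, hk⟩ ≤ S.ub ⟨k, hk⟩
      · by_cases hl' : S.lb ⟨k, hk⟩ ≤ D.X i ⟨k, hk⟩
        · simp [t₂ hu', t₁ hl', h6, hu', hl']
        · simp [t₂ hu', f₁ hl', hl']
      · simp [f₂ hu', hu']
  · refine ⟨rfl, ?_, by simp, by simp [h5], by simp⟩
    intro x hx hx' hx''
    ext j
    simp [hx, hx'']
  · rintro s' ⟨h1, h2, -, h4, h6⟩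
    refine ⟨h1, h2, by rw [h4]; ring, ?_⟩
    rw [h6]
    simp [IsMember]

theorem sum_range_eq_card {m : ℕ} (f : ℕ → ℕ) (p : Fin m → Prop) [DecidablePred p]
    (h : ∀ i : Fin m, f i = if p i then 1 else 0) :
    ∑ i ∈ Finset.range m, f i = Nat.card {i // p i} := by
  rw [Finset.sum_range]
  simp [h, Nat.card_eq_fintype_card, Fintype.card_subtype]

theorem evaluation_wracc_inPolyTime : (evaluation wracc).InPolyTime := by
  classical
  refine ⟨wraccProg, Polynomial.C 20 * Polynomial.X, ?_⟩
  rintro ⟨D, S⟩ s hs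
  obtain ⟨hn, hd, hS⟩ := (D.stores_eval_iff s wracc S).1 hs
  have h0 : s.nat 0 0 = D.m := hn 0 (by omega)
  have h1 : s.nat 0 1 = D.n := hn 1 (by omega)
  let mem : ℕ → ℕ := fun i => if h : i < D.m then if IsMember D S ⟨i, h⟩ then 1 else 0 else 0
  let pos : ℕ → ℕ := fun i => D.natCell (2 + i)
  let I : ℕ → Mem → Prop := fun i s' => s'.dat = s.dat ∧ s'.nat 0 = s.nat 0 ∧
    s'.nat 2 0 = D.m * D.n ∧ s'.nat 3 0 = i ∧ s'.nat 5 0 = i * D.n ∧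
    s'.nat 7 0 = ∑ i' ∈ Finset.range i, mem i' ∧ s'.nat 8 0 = ∑ i' ∈ Finset.range i, pos i' ∧
    s'.nat 9 0 = ∑ i' ∈ Finset.range i, (pos i' + mem i' - 1)
  have key : Runs wraccProg s (D.m * 3 + 3 + (1 + (1 + (1 + (1 + (D.m * (D.n * 7 + 6 + 2) + 2 +
      1)))))) (fun s' => s'.dat 1 0 = (wracc D S : EReal)) := by
    refine Runs.seq (Runs.mulNat D.m D.n (by simp) ?_) fun s₁ ⟨d₁, n₁, v₁⟩ => ?_
    · intro s' h
      simp [NExp.val, h 0, h0, h1]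
    refine Runs.seq (P := fun s' => s' = s₁.setNat 5 0 0) (Runs.setNat rfl) ?_
    rintro _ rfl
    refine Runs.seq (P := fun s' => s' = (s₁.setNat 5 0 0).setNat 7 0 0) (Runs.setNat rfl) ?_
    rintro _ rfl
    refine Runs.seq (P := fun s' => s' = ((s₁.setNat 5 0 0).setNat 7 0 0).setNat 8 0 0)
      (Runs.setNat rfl) ?_
    rintro _ rfl
    refine Runs.seq
      (P := fun s' => s' = (((s₁.setNat 5 0 0).setNat 7 0 0).setNat 8 0 0).setNat 9 0 0)
      (Runs.setNat rfl) ?_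
    rintro _ rfl
    refine Runs.seq (Runs.forLt I D.m ?_ ?_ ?_) ?_
    · rintro k s' - ⟨-, i0, -, i3, -⟩
      exact ⟨by simp [NExp.val, i0, h0], i3⟩
    · rintro k s' hk ⟨id, i0, i2, i3, i5, i7, i8, i9⟩
      refine (Runs.seq (T₂ := 3) (runs_memberProg (S := S) ⟨k, hk⟩ (by rw [i0, h1]) i2 i5 ?_ ?_)
        fun s₂ ⟨d₂, n₂, j5, j6⟩ => ?_).mono (by omega) fun _ h => h
      · intro j
        rw [id, hd _ (D.index_lt _ _), D.datCell_index]
      · rw [id]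
        exact hS
      have hmem : mem k = if IsMember D S ⟨k, hk⟩ then 1 else 0 := by simp [mem, hk]
      rw [← hmem] at j6
      have hpos : s₂.nat 0 (2 + k) = pos k := by
        rw [n₂ 0 (by simp) (by simp) (by simp), i0, hn _ (by omega)]
      refine Runs.seq (P := fun s' => s' = s₂.setNat 7 0 (s₂.nat 7 0 + s₂.nat 6 0)) (T₁ := 1)
        (T₂ := 2) (Runs.setNat rfl) ?_
      rintro _ rfl
      refine Runs.seq (P := fun s' => s' = (s₂.setNat 7 0 (s₂.nat 7 0 + s₂.nat 6 0)).setNat 8 0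
        (s₂.nat 8 0 + s₂.nat 0 (2 + s₂.nat 3 0))) (T₁ := 1)
        (T₂ := 1) (Runs.setNat (by simp [NExp.val])) ?_
      rintro _ rfl
      apply Runs.setNat
      have j0 : s₂.nat 0 = s.nat 0 := by rw [n₂ 0 (by simp) (by simp) (by simp), i0]
      have j3 : s₂.nat 3 0 = k := by rw [n₂ 3 (by simp) (by simp) (by simp), i3]
      refine ⟨by simp [j3], by simp [d₂, id], ?_, by simp [n₂ 2, i2], by simp, by simp [j5], ?_, ?_, ?_⟩
      · ext x
        simp [j0]
      · simp [Finset.sum_range_succ, n₂ 7, i7, j6]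
      · simp [Finset.sum_range_succ, n₂ 8, i8, j3, hpos]
      · simp [NExp.val, Finset.sum_range_succ, n₂ 9, i9, j3, hpos, j6]
    · refine ⟨d₁, ?_, by simp [v₁], by simp, by simp, by simp, by simp, by simp⟩
      ext x
      simp [n₁ 0]
    · rintro s' ⟨-, i0, -, -, -, i7, i8, i9⟩
      apply Runs.setDat
      rw [sum_range_eq_card mem (fun i => IsMember D S i) (by simp [mem])] at i7
      rw [sum_range_eq_card pos (fun i => D.y i = true) fun i => by
        cases h : D.y i <;> simp [pos, D.natCell_target, h]] at i8
      -- For bits, the truncated difference `pos + mem - 1` is their conjunction.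
      rw [sum_range_eq_card _ (fun i => IsMember D S i ∧ D.y i = true) fun i => by
        cases h : D.y i <;> by_cases h' : IsMember D S i <;>
          simp [pos, mem, D.natCell_target, h, h']] at i9
      -- Division by zero gives 0 both in `ℝ` and in `EReal`, so the coercion commutes with division
      -- even if there are no members or no data objects.
      simp only [NExp.val, DExp.val, Mem.setDat_dat, and_self, if_true, i0, i7, i8, i9, h0, wracc,
        ← EReal.coe_div, ← EReal.coe_sub, ← EReal.coe_mul]
  obtain ⟨s', t, he, ht, hv⟩ := key
  refine ⟨s', t, wracc D S, he, ht.trans ?_, rfl, ?_⟩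
  · simp [Problem.size, Word.size, evaluation, D.length_encodeNats, D.length_encodeData,
      Subgroup.encodeData]
    ring_nf
    omega
  · constructor
    · simp [evaluation]
    · simpa [evaluation] using hv

end SubgroupDiscovery

theorem mainTheorem10 :
    (∀ Q : SubgroupDiscovery.Quality, Q.DependsOnMembers →
      (SubgroupDiscovery.evaluation Q).InPolyTime →
        (SubgroupDiscovery.discovery Q).InXP fun D : SubgroupDiscovery.Dataset => D.n) ∧
    (SubgroupDiscovery.discovery SubgroupDiscovery.wracc).InXP
      fun D : SubgroupDiscovery.Dataset => D.n :=
  ⟨fun _ hQ h => SubgroupDiscovery.discovery_inXP hQ h,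
    SubgroupDiscovery.discovery_inXP SubgroupDiscovery.wracc_dependsOnMembers
      SubgroupDiscovery.evaluation_wracc_inPolyTime⟩
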